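/- **Setting.** Let $\mathcal X$ be a measurable space, $\mu$ a probability measure on $\mathcal X$, and $(S_n)_{n\ge 1}$ i.i.d. $\mathcal X$-valued random variables with law $\mu$ on a probability space $(\Omega,P)$. Let $\mu_N:=\frac1N\sum_{n\le N}\delta_{S_n}$ be the (random) empirical measure. Let $F,G_1,\dots,G_e:\mathcal X\to\mathbb R$ be bounded measurable functions ($e\in\mathbb N$), $p_1,\dots,p_e\in\mathbb R$, and let $\mathcal G\subset\mathbb R^e$ be a bounded set. For a functional $\rho^\nu(H)$ of a probability measure $\nu$ on $\mathcal X$ and a bounded measurable $H:\mathcal X\to\mathbb R$, put $$\pi^\nu(F):=\inf_{g\in\mathcal G}\rho^\nu\Big(F+\sum_{i=1}^e g_i(G_i-p_i)\Big).$$ All infima and limits are taken in $[-\infty,\infty]$, with $\inf\emptyset=+\infty$. A *loss function* is an increasing (not necessarily strictly) convex function $l:\mathbb R\to[0,\infty)$ with $1\in\partial l(0)$, i.e. $l(x)\ge l(0)+x$ for all $x\in\mathbb R$. Define $$\mathrm{OCE}^\nu(H):=\inf_{m\in\mathbb R}\Big(\int l(H-m)\,d\nu+m\Big),\qquad \mathrm{SF}^\nu(H):=\inf\Big\{m\in\mathbb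 R:\int l(H-m)\,d\nu\le 1\Big\}.$$ **Corollary (Consistency).** In each of the following cases, $\lim_{N\to\infty}\pi^{\mu_N}(F)=\pi^\mu(F)$ $P$-almost surely: 1. $\rho=\mathrm{OCE}$ for a loss function $l$; 2. $\rho=\mathrm{SF}$ for a strictly increasing loss function $l$; 3. $\rho:L^\infty(\Omega_0,P_0)\to\mathbb R$ is a law invariant convex risk measure on an atomless standard probability space, that is: $\rho(X+m)=\rho(X)+m$ for $m\in\mathbb R$ and $\rho(0)=0$; $\rho(X)\le\rho(Y)$ if $X\le Y$ a.s.; $\rho(\lambda X+(1-\lambda)Y)\le\lambda\rho(X)+(1-\lambda)\rho(Y)$ for $\lambda\in[0,1]$; $\rho(X)=\rho(Y)$ if $X$ and $Y$ have the same law. Moreover, for some $q\in(1,\infty)$, $\sup_n\rho(|X|\wedge n)<\infty$ for every random variable $X$ on $\Omega_0$ with finite weak $q$-th moment, i.e. such that for some $C\ge0$, $P_0[|X|\ge t]\le Ct^{-q}$ for all $t\ge1$. Here $\rho^\nu(H):=\rho(X)$ for any $X\in L^\infty(\Omega_0,P_0)$ with the law of $H$ under $\nu$. -/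

import Mathlib

open MeasureTheory ProbabilityTheory Filter Topology
open scoped ENNReal
universe w

/-- A loss function: `l : ℝ → ℝ₊` is increasing and convex, and `1` belongs to the
subdifferential of `l` at `0`. -/
structure IsLossFunction (l : ℝ → ℝ) : Prop where
  nonneg : ∀ x, 0 ≤ l x
  mono : Monotone l
  convex : ConvexOn ℝ Set.univ l
  one_mem_subdifferential : ∀ x, l 0 + 1 * (x - 0) ≤ l x

/-- The optimized certainty equivalent `inf_m (E^μ[l(F - m)] + m)`, as an infimum in `[-∞, ∞]`. -/
noncomputable def oce {𝒳 : Type*} [MeasurableSpace 𝒳] (l : ℝ → ℝ) (μ : Measure 𝒳)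
    (F : 𝒳 → ℝ) : EReal :=
  ⨅ m : ℝ, (((∫ x, l (F x - m) ∂μ) + m : ℝ) : EReal)

/-- The shortfall risk `inf {m ∈ ℝ : E^μ[l(F - m)] ≤ 1}`, as an infimum in `[-∞, ∞]`
(so that it is `+∞` if no such `m` exists). -/
noncomputable def shortfallRisk {𝒳 : Type*} [MeasurableSpace 𝒳] (l : ℝ → ℝ) (μ : Measure 𝒳)
    (F : 𝒳 → ℝ) : EReal :=
  ⨅ (m : ℝ) (_ : ∫ x, l (F x - m) ∂μ ≤ 1), (m : EReal)

/-- The minimal risk `π^μ(F) = inf_{g ∈ 𝒢} ρ^μ(F + ∑ i, g i * (G i - p i))` of the position `F`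
when trading in options `G i` at prices `p i` with strategies in `𝒢`; here `ρ μ F` stands
for `ρ^μ(F)`. -/
noncomputable def hedgedRisk {𝒳 : Type*} [MeasurableSpace 𝒳]
    (ρ : Measure 𝒳 → (𝒳 → ℝ) → EReal) {e : ℕ} (G : Fin e → 𝒳 → ℝ) (p : Fin e → ℝ)
    (𝒢 : Set (Fin e → ℝ)) (μ : Measure 𝒳) (F : 𝒳 → ℝ) : EReal :=
  ⨅ g ∈ 𝒢, ρ μ (fun x => F x + ∑ i, g i * (G i x - p i))

/-- The empirical measure `μ_N = (1/N) ∑_{n < N} δ_{S_n(ω)}` (used for `N ≥ 1`). -/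
noncomputable def empiricalMeasure {Ω 𝒳 : Type*} [MeasurableSpace 𝒳] (S : ℕ → Ω → 𝒳)
    (N : ℕ) (ω : Ω) : Measure 𝒳 :=
  (N : ℝ≥0∞)⁻¹ • ∑ n ∈ Finset.range N, Measure.dirac (S n ω)

/-- A law invariant (convex) risk measure on `L^∞(P₀)`, increasing in its argument. -/
structure IsLawInvariantRiskMeasure {Ω₀ : Type*} [MeasurableSpace Ω₀] (P₀ : Measure Ω₀)
    [IsProbabilityMeasure P₀] (ρ : Lp ℝ ∞ P₀ → ℝ) : Prop where
  map_add_const : ∀ (X : Lp ℝ ∞ P₀) (m : ℝ), ρ (X + Lp.const ∞ P₀ m) = ρ X + m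
  map_zero : ρ 0 = 0
  mono : ∀ X Y : Lp ℝ ∞ P₀, (∀ᵐ ω ∂P₀, X ω ≤ Y ω) → ρ X ≤ ρ Y
  convex : ∀ (X Y : Lp ℝ ∞ P₀) (t : ℝ), 0 ≤ t → t ≤ 1 →
    ρ (t • X + (1 - t) • Y) ≤ t * ρ X + (1 - t) * ρ Y
  law_invariant : ∀ X Y : Lp ℝ ∞ P₀, P₀.map X = P₀.map Y → ρ X = ρ Y

/-- `X` has finite weak `q`-th moment: `P₀[|X| ≥ t] ≤ C t ^ (-q)` for all `t ≥ 1`. -/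
def HasFiniteWeakMoment {Ω₀ : Type*} [MeasurableSpace Ω₀] (P₀ : Measure Ω₀) (q : ℝ)
    (X : Ω₀ → ℝ) : Prop :=
  ∃ C : ℝ, 0 ≤ C ∧ ∀ t : ℝ, 1 ≤ t → P₀.real {ω | t ≤ |X ω|} ≤ C * t ^ (-q)

/-- `ρ` takes finite values on random variables with finite weak `q`-th moment, in the sense that
`sup_n ρ(|X| ∧ n) < ∞` for each such `X`. -/
def FiniteOnWeakMoment {Ω₀ : Type*} [MeasurableSpace Ω₀] (P₀ : Measure Ω₀)
    (ρ : Lp ℝ ∞ P₀ → ℝ) (q : ℝ) : Prop :=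
  ∀ X : Ω₀ → ℝ, AEMeasurable X P₀ → HasFiniteWeakMoment P₀ q X →
    ∃ K : ℝ, ∀ (n : ℕ) (Y : Lp ℝ ∞ P₀), (∀ᵐ ω ∂P₀, Y ω = min |X ω| n) → ρ Y ≤ K

/-- `ρ^μ(F) = ρ(X)` for any `X ∈ L^∞(P₀)` distributed as `F(S)` with `S ∼ μ`. For a law invariant
`ρ` all such `X` give the same value, so that the infimum is over a single number. -/
noncomputable def riskUnderLaw {Ω₀ : Type*} [MeasurableSpace Ω₀] {P₀ : Measure Ω₀}
    (ρ : Lp ℝ ∞ P₀ → ℝ) {𝒳 : Type*} [MeasurableSpace 𝒳] (μ : Measure 𝒳) (F : 𝒳 → ℝ) : EReal :=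
  ⨅ (X : Lp ℝ ∞ P₀) (_ : P₀.map X = μ.map F), (ρ X : EReal)

/-! Each of the three functionals is monotone and cash additive, and boundedness of the `G i` makes
the hedged position Lipschitz in the strategy for the sup norm, so the risk is equicontinuous in the
strategy, uniformly over all probability measures. As `𝒢` is totally bounded, finite nets for
countably many accuracies reduce the infimum over `𝒢` to countably many strategies, hence to
countably many null sets (`ae_tendsto_biInf`, `ae_tendsto_hedgedRisk`). Estimates are stated through
real thresholds `a` because the risks may be infinite.

It remains to treat one bounded position `H`, where everything rests on the strong law. For the OCE
the infimum over `m` lives on a compact interval and the net argument applies again. For the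
shortfall risk, rational levels `m` suffice by monotonicity, and strict monotonicity of `l` turns
the constraint `≤ 1` into a strict one at larger levels.

For a law invariant `ρ`, the laws of `H` under two measures are coupled as quantile functions of one
uniform variable. The strong law at grid points makes the coupled variables close in probability, so
continuity of `ρ` in probability on bounded sets is needed (`exists_pos_forall_le_add`). Finiteness
on weak moments supplies it: a Pareto variable dominates large multiples of indicators of small
events, so by convexity such events carry little risk. -/

/-- Infima over a totally bounded set converge almost surely as soon as the functions are
equicontinuous on it and converge almost surely at every point. -/
theorem ae_tendsto_biInf {Ω Θ : Type*} [MeasurableSpace Ω] {P : Measure Ω} [PseudoMetricSpace Θ]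
    {T : Set Θ} (hT : TotallyBounded T) (R : ℕ → Ω → Θ → EReal) (r : Θ → EReal)
    (hR : ∀ ε : ℝ, 0 < ε → ∃ δ : ℝ, 0 < δ ∧ ∀ θ ∈ T, ∀ θ' ∈ T, dist θ θ' < δ → ∀ a : ℝ,
      (∀ N : ℕ, 1 ≤ N → ∀ ω, R N ω θ < a → R N ω θ' < (a + ε : ℝ)) ∧
      (r θ < a → r θ' < (a + ε : ℝ)))
    (hconv : ∀ θ ∈ T, ∀ᵐ ω ∂P, Tendsto (fun N => R N ω θ) atTop (𝓝 (r θ))) :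
    ∀ᵐ ω ∂P, Tendsto (fun N => ⨅ θ ∈ T, R N ω θ) atTop (𝓝 (⨅ θ ∈ T, r θ)) := by
  have hpos : ∀ n : ℕ, (0 : ℝ) < 1 / ((n : ℝ) + 1) := fun n => by positivity
  choose δ hδ hRδ using fun n : ℕ => hR _ (hpos n)
  have hnet : ∀ n, ∃ t ⊆ T, t.Finite ∧ ∀ θ ∈ T, ∃ θ' ∈ t, dist θ θ' < δ n := fun n => by
    obtain ⟨t, htT, htf, ht⟩ := hT.exists_subset (Metric.dist_mem_uniformity (hδ n))
    refine ⟨t, htT, htf, fun θ hθ => ?_⟩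
    simpa using ht hθ
  choose t htT htf ht using hnet
  -- The nets lie in `T` and their union over `n` is countable, so one null set serves all of them.
  have hae : ∀ᵐ ω ∂P, ∀ n, ∀ θ ∈ t n, Tendsto (fun N => R N ω θ) atTop (𝓝 (r θ)) := by
    rw [ae_all_iff]
    intro n
    rw [ae_ball_iff (htf n).countable]
    exact fun θ hθ => hconv θ (htT n hθ)
  filter_upwards [hae] with ω hω
  have hgap : ∀ c c' : ℝ, c < c' → ∃ n : ℕ, c + 1 / ((n : ℝ) + 1) < c' := fun c c' h => by
    obtain ⟨n, hn⟩ := exists_nat_one_div_lt (sub_pos.2 h)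
    exact ⟨n, by linarith⟩
  rw [tendsto_order]
  constructor
  · intro b hb
    obtain ⟨c, hbc, hc⟩ := EReal.lt_iff_exists_real_btwn.1 hb
    obtain ⟨c', hcc', hc'⟩ := EReal.lt_iff_exists_real_btwn.1 hc
    obtain ⟨n, hn⟩ := hgap c c' (EReal.coe_lt_coe_iff.1 hcc')
    have hev : ∀ᶠ N in atTop, ∀ θ ∈ t n, (c' : EReal) < R N ω θ := by
      rw [(htf n).eventually_all]
      exact fun θ hθ => (hω n θ hθ).eventually_const_lt
        (hc'.trans_le (iInf₂_le θ (htT n hθ)))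
    filter_upwards [hev, eventually_ge_atTop 1] with N hN hN1
    refine hbc.trans_le (le_iInf₂ fun θ hθ => ?_)
    -- A value below `c` at `θ` would force one below `c'` at a nearby net point.
    by_contra! hlt
    obtain ⟨θ', hθ', hd⟩ := ht n θ hθ
    have h1 := (hRδ n θ hθ θ' (htT n hθ') hd c).1 N hN1 ω hlt
    have h2 := (hN θ' hθ').trans h1
    rw [EReal.coe_lt_coe_iff] at h2
    linarith
  · intro b hb
    obtain ⟨c', hc', hcb⟩ := EReal.lt_iff_exists_real_btwn.1 hb
    obtain ⟨c, hc, hcc'⟩ := EReal.lt_iff_exists_real_btwn.1 hc'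
    obtain ⟨n, hn⟩ := hgap c c' (EReal.coe_lt_coe_iff.1 hcc')
    simp only [iInf_lt_iff] at hc
    obtain ⟨θ, hθ, hlt⟩ := hc
    obtain ⟨θ', hθ', hd⟩ := ht n θ hθ
    have h1 := (hRδ n θ hθ θ' (htT n hθ') hd c).2 hlt
    have h2 : r θ' < c' := h1.trans (EReal.coe_lt_coe_iff.2 hn)
    filter_upwards [(hω n θ' hθ').eventually_lt_const h2] with N hN
    exact ((iInf₂_le θ' (htT n hθ')).trans_lt hN).trans hcb

/-! ### Empirical measures and the strong law -/

theorem isProbabilityMeasure_empiricalMeasure {Ω 𝒳 : Type*} [MeasurableSpace 𝒳] (S : ℕ → Ω → 𝒳)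
    {N : ℕ} (hN : 1 ≤ N) (ω : Ω) : IsProbabilityMeasure (empiricalMeasure S N ω) where
  measure_univ := by
    have h : (N : ℝ≥0∞) ≠ 0 := by exact_mod_cast (by omega : N ≠ 0)
    simp [empiricalMeasure, ENNReal.inv_mul_cancel h (ENNReal.natCast_ne_top N)]

theorem integral_empiricalMeasure {Ω 𝒳 : Type*} [MeasurableSpace 𝒳] (S : ℕ → Ω → 𝒳)
    (N : ℕ) (ω : Ω) {f : 𝒳 → ℝ} (hf : Measurable f) :
    ∫ x, f x ∂(empiricalMeasure S N ω) = (∑ n ∈ Finset.range N, f (S n ω)) / N := by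
  rw [empiricalMeasure, integral_smul_measure, integral_finsetSum_measure]
  · simp [integral_dirac' _ _ hf.stronglyMeasurable, div_eq_inv_mul]
  · intro i _
    exact (integrable_dirac' hf.stronglyMeasurable (by simp))

theorem integrable_of_forall_abs_le {𝒳 : Type*} [MeasurableSpace 𝒳] {ν : Measure 𝒳}
    [IsFiniteMeasure ν] {f : 𝒳 → ℝ} (hf : Measurable f) {C : ℝ} (hC : ∀ x, |f x| ≤ C) :
    Integrable f ν :=
  Integrable.of_bound hf.aestronglyMeasurable C (Eventually.of_forall hC)

/-- The strong law of large numbers for integrals against empirical measures. -/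
theorem ae_tendsto_integral_empiricalMeasure {𝒳 Ω : Type*} [MeasurableSpace 𝒳]
    [MeasurableSpace Ω] {μ : Measure 𝒳} [IsProbabilityMeasure μ] {P : Measure Ω}
    {S : ℕ → Ω → 𝒳} (hS_indep : iIndepFun S P)
    (hS_law : ∀ n, HasLaw (S n) μ P) {f : 𝒳 → ℝ} (hf : Measurable f)
    (hf_bdd : ∃ C, ∀ x, |f x| ≤ C) :
    ∀ᵐ ω ∂P, Tendsto (fun N => ∫ x, f x ∂(empiricalMeasure S N ω)) atTop
      (𝓝 (∫ x, f x ∂μ)) := by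
  obtain ⟨C, hC⟩ := hf_bdd
  have hint : Integrable f μ := integrable_of_forall_abs_le hf hC
  have h0 : Integrable (fun ω => f (S 0 ω)) P := by
    have := (hS_law 0).map_eq ▸ hint
    exact this.comp_aemeasurable (hS_law 0).aemeasurable
  have hlim := strong_law_ae_real (fun n ω => f (S n ω)) h0
    (fun i j hij => (hS_indep.indepFun hij).comp hf hf)
    (fun i => ((hS_law i).identDistrib (hS_law 0)).comp hf)
  have hmean : ∫ ω, f (S 0 ω) ∂P = ∫ x, f x ∂μ :=
    (hS_law 0).integral_comp hf.aestronglyMeasurable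
  filter_upwards [hlim] with ω hω
  rw [hmean] at hω
  simpa only [integral_empiricalMeasure S _ ω hf] using hω

/-! ### Reduction to a single position -/

/-- The functional `ρ` is monotone and cash additive under the measure `ν`, on bounded measurable
positions. -/
def MonotoneCashAdditive {𝒳 : Type*} [MeasurableSpace 𝒳]
    (ρ : Measure 𝒳 → (𝒳 → ℝ) → EReal) (ν : Measure 𝒳) : Prop :=
  ∀ H H' : 𝒳 → ℝ, Measurable H → Measurable H' → (∃ C, ∀ x, |H x| ≤ C) →
    (∃ C, ∀ x, |H' x| ≤ C) → ∀ ε : ℝ, (∀ x, H' x ≤ H x + ε) →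
      ∀ a : ℝ, ρ ν H < a → ρ ν H' < (a + ε : ℝ)

theorem exists_forall_abs_position_le {𝒳 : Type*} {F : 𝒳 → ℝ} (hF_bdd : ∃ C, ∀ x, |F x| ≤ C)
    {e : ℕ} {G : Fin e → 𝒳 → ℝ} (hG_bdd : ∀ i, ∃ C, ∀ x, |G i x| ≤ C)
    (p g : Fin e → ℝ) : ∃ C, ∀ x, |F x + ∑ i, g i * (G i x - p i)| ≤ C := by
  obtain ⟨C, hC⟩ := hF_bdd
  choose D hD using hG_bdd
  refine ⟨C + ∑ i, |g i| * (D i + |p i|), fun x => (abs_add_le _ _).trans (add_le_add (hC x) ?_)⟩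
  refine (Finset.abs_sum_le_sum_abs _ _).trans (Finset.sum_le_sum fun i _ => ?_)
  rw [abs_mul]
  exact mul_le_mul_of_nonneg_left ((abs_sub _ _).trans (by linarith [hD i x])) (abs_nonneg _)

/-- Consistency of the hedged risk reduces to consistency at every single bounded position. -/
theorem ae_tendsto_hedgedRisk {𝒳 Ω : Type*} [MeasurableSpace 𝒳] [MeasurableSpace Ω]
    {μ : Measure 𝒳} [IsProbabilityMeasure μ] {P : Measure Ω} {S : ℕ → Ω → 𝒳}
    {F : 𝒳 → ℝ} (hF : Measurable F) (hF_bdd : ∃ C, ∀ x, |F x| ≤ C)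
    {e : ℕ} {G : Fin e → 𝒳 → ℝ} (hG : ∀ i, Measurable (G i)) (hG_bdd : ∀ i, ∃ C, ∀ x, |G i x| ≤ C)
    (p : Fin e → ℝ) {𝒢 : Set (Fin e → ℝ)} (h𝒢 : Bornology.IsBounded 𝒢)
    {ρ : Measure 𝒳 → (𝒳 → ℝ) → EReal}
    (hρ : ∀ ν : Measure 𝒳, IsProbabilityMeasure ν → MonotoneCashAdditive ρ ν)
    (hconv : ∀ H : 𝒳 → ℝ, Measurable H → (∃ C, ∀ x, |H x| ≤ C) →
      ∀ᵐ ω ∂P, Tendsto (fun N => ρ (empiricalMeasure S N ω) H) atTop (𝓝 (ρ μ H))) :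
    ∀ᵐ ω ∂P, Tendsto (fun N => hedgedRisk ρ G p 𝒢 (empiricalMeasure S N ω) F) atTop
      (𝓝 (hedgedRisk ρ G p 𝒢 μ F)) := by
  have hmeas : ∀ g : Fin e → ℝ, Measurable fun x => F x + ∑ i, g i * (G i x - p i) :=
    fun g => by fun_prop
  have hbdd := exists_forall_abs_position_le hF_bdd hG_bdd p
  choose D hD using hG_bdd
  -- `K` is a Lipschitz constant of the position in the strategy, uniformly in `x`.
  set K := ∑ i, abs (D i + abs (p i))
  have hK : 0 ≤ K := Finset.sum_nonneg fun i _ => abs_nonneg _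
  refine ae_tendsto_biInf (h𝒢.isCompact_closure.totallyBounded.subset subset_closure)
    (fun N ω g => ρ (empiricalMeasure S N ω) fun x => F x + ∑ i, g i * (G i x - p i))
    (fun g => ρ μ fun x => F x + ∑ i, g i * (G i x - p i)) (fun ε hε => ?_)
    (fun g _ => hconv _ (hmeas g) (hbdd g))
  refine ⟨ε / (K + 1), by positivity, fun g _ g' _ hgg' a => ?_⟩
  have hle : ∀ x, F x + ∑ i, g' i * (G i x - p i) ≤ F x + ∑ i, g i * (G i x - p i) + ε := by
    intro x
    have hsum : ∑ i, g' i * (G i x - p i) - ∑ i, g i * (G i x - p i) ≤ dist g g' * K := by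
      rw [← Finset.sum_sub_distrib, Finset.mul_sum]
      refine Finset.sum_le_sum fun i _ => ?_
      rw [← sub_mul]
      refine (le_abs_self _).trans ?_
      rw [abs_mul]
      refine mul_le_mul ?_ ?_ (abs_nonneg _) dist_nonneg
      · rw [abs_sub_comm]
        exact dist_le_pi_dist g g' i
      · exact (abs_sub _ _).trans ((add_le_add_left (hD i x) _).trans (le_abs_self _))
    have : dist g g' * K ≤ ε := by
      have h1 : dist g g' * K ≤ ε / (K + 1) * K := by gcongr
      have h2 : ε / (K + 1) * K ≤ ε := by
        rw [div_mul_eq_mul_div, div_le_iff₀ (by positivity)]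
        nlinarith
      exact h1.trans h2
    linarith
  exact ⟨fun N hN ω => hρ _ (isProbabilityMeasure_empiricalMeasure S hN ω) _ _ (hmeas g) (hmeas g')
    (hbdd g) (hbdd g') ε hle a, hρ _ inferInstance _ _ (hmeas g) (hmeas g') (hbdd g) (hbdd g') ε hle a⟩

/-! ### Loss functions, OCE and shortfall risk -/

namespace IsLossFunction

variable {l : ℝ → ℝ}

theorem continuous (hl : IsLossFunction l) : Continuous l :=
  continuousOn_univ.1 (hl.convex.continuousOn isOpen_univ)

/-- The function `x ↦ l x - x` is monotone away from its minimizer `0`. -/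
theorem sub_le_sub_of_mem_uIcc (hl : IsLossFunction l) {x y : ℝ} (hx : x ∈ Set.uIcc 0 y) :
    l x - x ≤ l y - y := by
  have hconv : ConvexOn ℝ Set.univ fun x => l x - x :=
    hl.convex.sub (concaveOn_id convex_univ)
  have h0 : ∀ y, l 0 - 0 ≤ l y - y := fun y => by linarith [hl.one_mem_subdifferential y]
  refine (hconv.le_max_of_mem_segment (Set.mem_univ 0) (Set.mem_univ y)
    (segment_eq_uIcc (0 : ℝ) y ▸ hx)).trans ?_
  exact max_le (h0 y) le_rfl

theorem exists_forall_abs_comp_sub_le (hl : IsLossFunction l) {𝒳 : Type*} {H : 𝒳 → ℝ} (hH_bdd : ∃ C, ∀ x, |H x| ≤ C)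
    (m : ℝ) : ∃ C, ∀ x, |l (H x - m)| ≤ C := by
  obtain ⟨C, hC⟩ := hH_bdd
  refine ⟨l (C - m), fun x => ?_⟩
  rw [abs_of_nonneg (hl.nonneg _)]
  exact hl.mono (by linarith [(abs_le.1 (hC x)).2])

variable {𝒳 : Type*} [MeasurableSpace 𝒳] {H : 𝒳 → ℝ}

theorem measurable_comp_sub (hl : IsLossFunction l) (hH : Measurable H) (m : ℝ) :
    Measurable fun x => l (H x - m) :=
  hl.continuous.measurable.comp (hH.sub_const m)

theorem integrable_comp_sub (hl : IsLossFunction l) (hH : Measurable H)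
    (hH_bdd : ∃ C, ∀ x, |H x| ≤ C) (m : ℝ) (ν : Measure 𝒳) [IsFiniteMeasure ν] :
    Integrable (fun x => l (H x - m)) ν := by
  obtain ⟨C, hC⟩ := hl.exists_forall_abs_comp_sub_le hH_bdd m
  exact integrable_of_forall_abs_le (hl.measurable_comp_sub hH m) hC

end IsLossFunction

section LossFunction

variable {𝒳 : Type*} [MeasurableSpace 𝒳] {l : ℝ → ℝ}

theorem monotoneCashAdditive_oce (hl : IsLossFunction l) (ν : Measure 𝒳)
    [IsProbabilityMeasure ν] : MonotoneCashAdditive (oce l) ν := by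
  intro H H' hH hH' hb hb' ε hle a ha
  obtain ⟨m, hm⟩ := iInf_lt_iff.1 ha
  refine (iInf_le _ (m + ε)).trans_lt ?_
  rw [EReal.coe_lt_coe_iff] at hm ⊢
  have : ∫ x, l (H' x - (m + ε)) ∂ν ≤ ∫ x, l (H x - m) ∂ν :=
    integral_mono (hl.integrable_comp_sub hH' hb' _ ν) (hl.integrable_comp_sub hH hb _ ν)
      fun x => hl.mono (by linarith [hle x])
  linarith

theorem monotoneCashAdditive_shortfallRisk (hl : IsLossFunction l) (ν : Measure 𝒳)
    [IsProbabilityMeasure ν] : MonotoneCashAdditive (shortfallRisk l) ν := by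
  intro H H' hH hH' hb hb' ε hle a ha
  simp only [shortfallRisk, iInf_lt_iff] at ha ⊢
  obtain ⟨m, hm, hma⟩ := ha
  refine ⟨m + ε, le_trans ?_ hm, ?_⟩
  · exact integral_mono (hl.integrable_comp_sub hH' hb' _ ν) (hl.integrable_comp_sub hH hb _ ν)
      fun x => hl.mono (by linarith [hle x])
  · rw [EReal.coe_lt_coe_iff] at hma ⊢
    linarith

/-- The infimum defining the optimized certainty equivalent of a position bounded by `C` may be
restricted to `[-C, C]`. -/
theorem oce_eq_biInf_Icc (hl : IsLossFunction l) {H : 𝒳 → ℝ} (hH : Measurable H) {C : ℝ}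
    (hC : ∀ x, |H x| ≤ C) (hC0 : 0 ≤ C) (ν : Measure 𝒳) [IsProbabilityMeasure ν] :
    oce l ν H = ⨅ m ∈ Set.Icc (-C) C, (((∫ x, l (H x - m) ∂ν) + m : ℝ) : EReal) := by
  -- Up to the constant position, the objective integrates `y ↦ l y - y` at `y = H x - m`; moving
  -- `m` so that every `H x - m` moves towards `0` can only lower it.
  have key : ∀ m m' : ℝ, (∀ x, H x - m' ∈ Set.uIcc 0 (H x - m)) →
      (∫ x, l (H x - m') ∂ν) + m' ≤ (∫ x, l (H x - m) ∂ν) + m := by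
    intro m m' h
    have h1 : ∫ x, l (H x - m') ∂ν ≤ ∫ x, (l (H x - m) + (m - m')) ∂ν :=
      integral_mono (hl.integrable_comp_sub hH ⟨C, hC⟩ _ ν)
        ((hl.integrable_comp_sub hH ⟨C, hC⟩ _ ν).add (integrable_const _))
        fun x => by
          have := hl.sub_le_sub_of_mem_uIcc (h x)
          dsimp only
          linarith
    rw [integral_add (hl.integrable_comp_sub hH ⟨C, hC⟩ _ ν) (integrable_const _)] at h1
    simp only [integral_const, probReal_univ, one_smul] at h1
    linarith
  refine le_antisymm (le_iInf₂ fun m _ => iInf_le _ m) (le_iInf fun m => ?_)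
  rcases le_total m (-C) with hm | hm
  · refine (iInf₂_le (-C) (by constructor <;> linarith)).trans (EReal.coe_le_coe_iff.2 (key _ _ ?_))
    intro x
    have := abs_le.1 (hC x)
    exact Set.mem_uIcc.2 (Or.inl ⟨by linarith, by linarith⟩)
  · rcases le_total m C with hm' | hm'
    · exact iInf₂_le m ⟨hm, hm'⟩
    · refine (iInf₂_le C (by constructor <;> linarith)).trans (EReal.coe_le_coe_iff.2 (key _ _ ?_))
      intro x
      have := abs_le.1 (hC x)
      exact Set.mem_uIcc.2 (Or.inr ⟨by linarith, by linarith⟩)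

variable {Ω : Type*} [MeasurableSpace Ω] {μ : Measure 𝒳} [IsProbabilityMeasure μ] {P : Measure Ω}
  {S : ℕ → Ω → 𝒳}

theorem ae_tendsto_oce (hl : IsLossFunction l) (hS_indep : iIndepFun S P)
    (hS_law : ∀ n, HasLaw (S n) μ P) {H : 𝒳 → ℝ} (hH : Measurable H)
    (hH_bdd : ∃ C, ∀ x, |H x| ≤ C) :
    ∀ᵐ ω ∂P, Tendsto (fun N => oce l (empiricalMeasure S N ω) H) atTop (𝓝 (oce l μ H)) := by
  obtain ⟨C, hC0, hC⟩ : ∃ C, 0 ≤ C ∧ ∀ x, |H x| ≤ C := by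
    obtain ⟨C, hC⟩ := hH_bdd
    exact ⟨|C|, abs_nonneg _, fun x => (hC x).trans (le_abs_self _)⟩
  -- For `m ∈ [-C, C]` all arguments `H x - m` lie in `[-2C, 2C]`.
  have hunif := isCompact_Icc.uniformContinuousOn_of_continuous
    (hl.continuous.continuousOn (s := Set.Icc (-(2 * C)) (2 * C)))
  rw [Metric.uniformContinuousOn_iff] at hunif
  have hlim := ae_tendsto_biInf (P := P) (isCompact_Icc (a := -C) (b := C)).totallyBounded
    (fun N ω m => (((∫ x, l (H x - m) ∂(empiricalMeasure S N ω)) + m : ℝ) : EReal))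
    (fun m => (((∫ x, l (H x - m) ∂μ) + m : ℝ) : EReal)) (fun ε hε => ?_) (fun m _ => ?_)
  · filter_upwards [hlim] with ω hω
    rw [oce_eq_biInf_Icc hl hH hC hC0 μ]
    refine hω.congr' ?_
    filter_upwards [eventually_ge_atTop 1] with N hN
    have := isProbabilityMeasure_empiricalMeasure S hN ω
    exact (oce_eq_biInf_Icc hl hH hC hC0 _).symm
  · obtain ⟨δ, hδ, h⟩ := hunif (ε / 2) (by positivity)
    -- Half of `ε` pays for the oscillation of `l`, half for the change of the cash term `m`.
    refine ⟨min δ (ε / 2), by positivity, fun m hm m' hm' hd a => ?_⟩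
    have key : ∀ ν : Measure 𝒳, IsProbabilityMeasure ν →
        (((∫ x, l (H x - m) ∂ν) + m : ℝ) : EReal) < a →
        (((∫ x, l (H x - m') ∂ν) + m' : ℝ) : EReal) < (a + ε : ℝ) := by
      intro ν _ hlt
      rw [EReal.coe_lt_coe_iff] at hlt ⊢
      have h1 : ∫ x, l (H x - m') ∂ν ≤ ∫ x, (l (H x - m) + ε / 2) ∂ν := by
        refine integral_mono (hl.integrable_comp_sub hH ⟨C, hC⟩ _ ν)
          ((hl.integrable_comp_sub hH ⟨C, hC⟩ _ ν).add (integrable_const _)) fun x => ?_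
        have hx := abs_le.1 (hC x)
        have := h (H x - m') ⟨by linarith [hm'.2], by linarith [hm'.1]⟩ (H x - m)
          ⟨by linarith [hm.2], by linarith [hm.1]⟩
          (by
            rw [Real.dist_eq] at hd ⊢
            rw [show H x - m' - (H x - m) = m - m' by ring]
            exact hd.trans_le (min_le_left _ _))
        rw [Real.dist_eq] at this
        dsimp only
        linarith [(abs_lt.1 this).2]
      rw [integral_add (hl.integrable_comp_sub hH ⟨C, hC⟩ _ ν) (integrable_const _)] at h1
      simp only [integral_const, probReal_univ, one_smul] at h1
      have h2 := hd.trans_le (min_le_right _ _)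
      rw [Real.dist_eq] at h2
      linarith [(abs_lt.1 h2).1]
    exact ⟨fun N hN ω => key _ (isProbabilityMeasure_empiricalMeasure S hN ω), key μ inferInstance⟩
  · filter_upwards [ae_tendsto_integral_empiricalMeasure hS_indep hS_law
      (hl.measurable_comp_sub hH m) (hl.exists_forall_abs_comp_sub_le ⟨C, hC⟩ m)] with ω hω
    exact (continuous_coe_real_ereal.tendsto _).comp (hω.add_const m)

theorem ae_tendsto_shortfallRisk (hl : IsLossFunction l) (hl_strict : StrictMono l)
    (hS_indep : iIndepFun S P) (hS_law : ∀ n, HasLaw (S n) μ P) {H : 𝒳 → ℝ} (hH : Measurable H)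
    (hH_bdd : ∃ C, ∀ x, |H x| ≤ C) :
    ∀ᵐ ω ∂P, Tendsto (fun N => shortfallRisk l (empiricalMeasure S N ω) H) atTop
      (𝓝 (shortfallRisk l μ H)) := by
  have hae : ∀ᵐ ω ∂P, ∀ m : ℚ, Tendsto
      (fun N => ∫ x, l (H x - m) ∂(empiricalMeasure S N ω)) atTop (𝓝 (∫ x, l (H x - m) ∂μ)) :=
    ae_all_iff.2 fun m => ae_tendsto_integral_empiricalMeasure hS_indep hS_law
      (hl.measurable_comp_sub hH m) (hl.exists_forall_abs_comp_sub_le hH_bdd m)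
  have hint : ∀ (m : ℝ), Integrable (fun x => l (H x - m)) μ :=
    fun m => hl.integrable_comp_sub hH hH_bdd m μ
  have hstrict : ∀ m m' : ℝ, m < m' → ∫ x, l (H x - m') ∂μ < ∫ x, l (H x - m) ∂μ := by
    intro m m' hmm'
    have hlt : ∀ x, l (H x - m') < l (H x - m) := fun x => hl_strict (by linarith)
    rw [← sub_pos, ← integral_sub (hint _) (hint _),
      integral_pos_iff_support_of_nonneg (fun x => (sub_pos.2 (hlt x)).le)
        ((hint _).sub (hint _))]
    have : Function.support (fun x => l (H x - m) - l (H x - m')) = Set.univ :=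
      Set.eq_univ_of_forall fun x => (sub_pos.2 (hlt x)).ne'
    rw [this]
    simp
  filter_upwards [hae] with ω hω
  rw [tendsto_order]
  constructor
  · intro b hb
    obtain ⟨m, hbm, hm⟩ := EReal.lt_iff_exists_rat_btwn.1 hb
    -- A level below the limit violates the constraint strictly, so it and all smaller levels remain
    -- unacceptable for large `N`.
    have h1 : 1 < ∫ x, l (H x - m) ∂μ := by
      by_contra! hle
      exact hm.not_ge (iInf₂_le (f := fun (m : ℝ) (_ : ∫ x, l (H x - m) ∂μ ≤ 1) => (m : EReal)) (m : ℝ) hle)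
    filter_upwards [(hω m).eventually_const_lt h1, eventually_ge_atTop 1] with N hN hN1
    have := isProbabilityMeasure_empiricalMeasure S hN1 ω
    refine hbm.trans_le (le_iInf₂ fun m' hm' => EReal.coe_le_coe_iff.2 ?_)
    by_contra! hlt
    refine hm'.not_gt (hN.trans_le ?_)
    exact integral_mono (hl.integrable_comp_sub hH hH_bdd _ _)
      (hl.integrable_comp_sub hH hH_bdd _ _) fun x => hl.mono (by linarith)
  · intro b hb
    have hb' := hb
    simp only [shortfallRisk, iInf_lt_iff] at hb'
    obtain ⟨m₀, hm₀, hm₀b⟩ := hb'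
    obtain ⟨m, hm, hmb⟩ := EReal.lt_iff_exists_rat_btwn.1 hm₀b
    -- Strictness is essential: a mere `≤ 1` need not survive the approximation of `μ`.
    have h1 : ∫ x, l (H x - m) ∂μ < 1 := (hstrict _ _ (EReal.coe_lt_coe_iff.1 hm)).trans_le hm₀
    filter_upwards [(hω m).eventually_lt_const h1] with N hN
    exact (iInf₂_le (m : ℝ) hN.le).trans_lt hmb

end LossFunction

/-! ### A uniform variable on an atomless space -/

section Uniform

variable {Ω₀ : Type*} [MeasurableSpace Ω₀]

/-- `U` is uniformly distributed on `(0, 1]` under `P₀`. -/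
structure IsUniformOnUnit (P₀ : Measure Ω₀) (U : Ω₀ → ℝ) : Prop where
  measurable : Measurable U
  mem_Ioc : ∀ ω, U ω ∈ Set.Ioc 0 1
  measureReal_le : ∀ t ∈ Set.Icc (0 : ℝ) 1, P₀.real {ω | U ω ≤ t} = t

theorem continuous_cdf (ν : Measure ℝ) [IsProbabilityMeasure ν] [NullSingletonClass ν] :
    Continuous (cdf ν) := by
  refine continuous_iff_continuousAt.2 fun x => continuousAt_iff_continuous_left'_right'.2 ⟨?_, ?_⟩
  · rw [(monotone_cdf ν).continuousWithinAt_Iio_iff_leftLim_eq]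
    have h := (cdf ν).measure_singleton x
    rw [measure_cdf, measure_singleton, eq_comm, ENNReal.ofReal_eq_zero] at h
    exact le_antisymm ((monotone_cdf ν).leftLim_le le_rfl) (by linarith)
  · exact continuousWithinAt_Ioi_iff_Ici.2 ((cdf ν).right_continuous x)

/-- An atomless standard Borel probability space carries a uniformly distributed variable. -/
theorem exists_isUniformOnUnit [StandardBorelSpace Ω₀] (P₀ : Measure Ω₀)
    [IsProbabilityMeasure P₀] [NullSingletonClass P₀] : ∃ U, IsUniformOnUnit P₀ U := by
  set Z := embeddingReal Ω₀
  have hZ : Measurable Z := measurable_embeddingReal Ω₀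
  set ν := P₀.map Z with hν
  have : IsProbabilityMeasure ν := Measure.isProbabilityMeasure_map hZ.aemeasurable
  have : NullSingletonClass ν := ⟨fun x => by
    rw [hν, Measure.map_apply hZ (measurableSet_singleton x)]
    exact (Set.subsingleton_singleton.preimage
      (measurableEmbedding_embeddingReal Ω₀).injective).measure_zero P₀⟩
  set V : Ω₀ → ℝ := fun ω => cdf ν (Z ω)
  have hV : Measurable V := (monotone_cdf ν).measurable.comp hZ
  have hZ_law : ∀ x, P₀.real {ω | Z ω ≤ x} = cdf ν x := fun x => by
    rw [cdf_eq_real, hν, map_measureReal_apply hZ measurableSet_Iic]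
    rfl
  have hsurj : ∀ s ∈ Set.Ioo (0 : ℝ) 1, ∃ x, cdf ν x = s := fun s hs =>
    mem_range_of_exists_le_of_exists_ge (continuous_cdf ν)
      (((tendsto_cdf_atBot ν).eventually_le_const hs.1).exists)
      (((tendsto_cdf_atTop ν).eventually_const_le hs.2).exists)
  have hV_law : ∀ t ∈ Set.Icc (0 : ℝ) 1, P₀.real {ω | V ω ≤ t} = t := by
    intro t ht
    apply le_antisymm
    -- For `s > t` with `cdf ν x = s`, the event `V ≤ t` is contained in `Z ≤ x`, of probability
    -- `s`.
    · refine le_of_forall_gt_imp_ge_of_dense fun s hts => ?_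
      rcases le_or_gt 1 s with h1 | h1
      · exact measureReal_le_one.trans h1
      obtain ⟨x, hx⟩ := hsurj s ⟨ht.1.trans_lt hts, h1⟩
      rw [← hx, ← hZ_law]
      refine measureReal_mono fun ω hω => ?_
      by_contra hlt
      have : cdf ν x ≤ cdf ν (Z ω) := monotone_cdf ν (not_le.1 hlt).le
      exact (hω.trans_lt hts).not_ge (hx ▸ this)
    · rcases ht.1.eq_or_lt with h0 | h0
      · exact h0 ▸ measureReal_nonneg
      rcases ht.2.eq_or_lt with h1 | h1
      · have : {ω | V ω ≤ t} = Set.univ :=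
          Set.eq_univ_of_forall fun ω => h1 ▸ cdf_le_one ν (Z ω)
        rw [this, probReal_univ, h1]
      obtain ⟨x, hx⟩ := hsurj t ⟨h0, h1⟩
      conv_lhs => rw [← hx, ← hZ_law]
      exact measureReal_mono fun ω hω => hx ▸ monotone_cdf ν hω
  have hV_pos : ∀ᵐ ω ∂P₀, 0 < V ω := by
    have h := hV_law 0 (by simp)
    rw [measureReal_eq_zero_iff] at h
    simpa [ae_iff] using h
  -- Redefining `V` on a null set keeps it in `(0, 1]` everywhere; at `0` the set defining the
  -- quantile is not bounded below.
  refine ⟨fun ω => if 0 < V ω then V ω else 1,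
    Measurable.ite (measurableSet_lt measurable_const hV) hV measurable_const, fun ω => ?_,
    fun t ht => ?_⟩
  · split_ifs with h
    · exact ⟨h, cdf_le_one ν _⟩
    · exact ⟨one_pos, le_rfl⟩
  · refine (measureReal_congr (eventuallyEq_set.2 ?_)).trans (hV_law t ht)
    filter_upwards [hV_pos] with ω hω
    simp only [if_pos hω]

theorem IsUniformOnUnit.measureReal_Ioc_le {P₀ : Measure Ω₀} [IsProbabilityMeasure P₀]
    {U : Ω₀ → ℝ} (hU : IsUniformOnUnit P₀ U) {a b : ℝ} (ha : a ∈ Set.Icc (0 : ℝ) 1)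
    (hb : b ∈ Set.Icc (0 : ℝ) 1) : P₀.real {ω | a < U ω ∧ U ω ≤ b} ≤ |b - a| := by
  rcases le_total a b with hab | hab
  · have hset : {ω | a < U ω ∧ U ω ≤ b} = {ω | U ω ≤ b} \ {ω | U ω ≤ a} := by
      ext ω
      simp [and_comm]
    have hsub : {ω | U ω ≤ a} ⊆ {ω | U ω ≤ b} := fun ω (h : U ω ≤ a) => h.trans hab
    rw [hset, measureReal_sdiff hsub (hU.measurable measurableSet_Iic), hU.measureReal_le a ha,
      hU.measureReal_le b hb]
    exact le_abs_self _
  · have : {ω | a < U ω ∧ U ω ≤ b} = ∅ :=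
      Set.eq_empty_of_forall_notMem fun ω h => (h.1.trans_le (h.2.trans hab)).false
    rw [this, measureReal_empty]
    exact abs_nonneg _

end Uniform

/-! ### Quantile functions and their coupling -/

section Quantile

variable {𝒳 : Type*} [MeasurableSpace 𝒳]

/-- The left quantile function of `H` under `ν`. -/
noncomputable def quantile (ν : Measure 𝒳) (H : 𝒳 → ℝ) (u : ℝ) : ℝ :=
  sInf {x | u ≤ ν.real {y | H y ≤ x}}

variable {ν : Measure 𝒳} [IsProbabilityMeasure ν] {H : 𝒳 → ℝ} {C : ℝ}

/-- Right continuity of the distribution function makes the infimum attained. This Galois connection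
carries all later facts on quantiles. -/
theorem quantile_le_iff (hH : Measurable H) (hC : ∀ x, |H x| ≤ C) {u : ℝ}
    (hu : u ∈ Set.Ioc (0 : ℝ) 1) (x : ℝ) : quantile ν H u ≤ x ↔ u ≤ ν.real {y | H y ≤ x} := by
  have hne : {x | u ≤ ν.real {y | H y ≤ x}}.Nonempty := by
    refine ⟨C, ?_⟩
    have : {y | H y ≤ C} = Set.univ := Set.eq_univ_of_forall fun y => (abs_le.1 (hC y)).2
    simpa [this] using hu.2
  have hbdd : BddBelow {x | u ≤ ν.real {y | H y ≤ x}} := by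
    refine ⟨-C, fun x hx => ?_⟩
    by_contra! hlt
    have : {y | H y ≤ x} = ∅ := Set.eq_empty_of_forall_notMem fun y (hy : H y ≤ x) =>
      ((abs_le.1 (hC y)).1.trans hy).not_gt hlt
    simp only [Set.mem_ofPred_eq, this, measureReal_empty] at hx
    exact hx.not_gt hu.1
  have hprob : IsProbabilityMeasure (ν.map H) := Measure.isProbabilityMeasure_map hH.aemeasurable
  have hcdf : ∀ x, ν.real {y | H y ≤ x} = cdf (ν.map H) x := fun x => by
    rw [cdf_eq_real, map_measureReal_apply hH measurableSet_Iic]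
    rfl
  refine ⟨fun h => ?_, fun h => csInf_le hbdd h⟩
  have hlim := continuousWithinAt_Ioi_iff_Ici.2 ((cdf (ν.map H)).right_continuous x)
  rw [hcdf]
  refine ge_of_tendsto hlim (eventually_nhdsWithin_of_forall fun y hy => ?_)
  obtain ⟨z, hz, hzy⟩ := exists_lt_of_csInf_lt hne (h.trans_lt hy)
  exact (hz.trans (hcdf z).le).trans (monotone_cdf _ hzy.le)

theorem abs_quantile_le (hH : Measurable H) (hC : ∀ x, |H x| ≤ C) {u : ℝ}
    (hu : u ∈ Set.Ioc (0 : ℝ) 1) : |quantile ν H u| ≤ C := by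
  refine abs_le.2 ⟨?_, ?_⟩
  · by_contra! hlt
    have h := (quantile_le_iff (ν := ν) hH hC hu _).1 le_rfl
    have : {y | H y ≤ quantile ν H u} = ∅ := Set.eq_empty_of_forall_notMem
      fun y (hy : H y ≤ _) => ((abs_le.1 (hC y)).1.trans hy).not_gt hlt
    rw [this, measureReal_empty] at h
    exact h.not_gt hu.1
  · rw [quantile_le_iff hH hC hu]
    have : {y | H y ≤ C} = Set.univ := Set.eq_univ_of_forall fun y => (abs_le.1 (hC y)).2
    simpa [this] using hu.2

theorem quantile_le_quantile_add (hH : Measurable H) (hC : ∀ x, |H x| ≤ C) {H' : 𝒳 → ℝ}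
    (hH' : Measurable H') {C' : ℝ} (hC' : ∀ x, |H' x| ≤ C') {ε : ℝ} (hle : ∀ x, H' x ≤ H x + ε)
    {u : ℝ} (hu : u ∈ Set.Ioc (0 : ℝ) 1) : quantile ν H' u ≤ quantile ν H u + ε := by
  rw [quantile_le_iff hH' hC' hu]
  refine ((quantile_le_iff (ν := ν) hH hC hu _).1 le_rfl).trans (measureReal_mono fun y hy => ?_)
  exact (hle y).trans (add_le_add_left hy ε)

variable {Ω₀ : Type*} [MeasurableSpace Ω₀] {P₀ : Measure Ω₀} {U : Ω₀ → ℝ}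

theorem measurable_quantile_comp (hH : Measurable H) (hC : ∀ x, |H x| ≤ C)
    (hU : IsUniformOnUnit P₀ U) : Measurable fun ω => quantile ν H (U ω) := by
  refine measurable_of_Iic fun x => ?_
  have : (fun ω => quantile ν H (U ω)) ⁻¹' Set.Iic x = {ω | U ω ≤ ν.real {y | H y ≤ x}} := by
    ext ω
    exact quantile_le_iff hH hC (hU.mem_Ioc ω) x
  rw [this]
  exact hU.measurable measurableSet_Iic

theorem map_quantile_comp [IsProbabilityMeasure P₀] (hH : Measurable H) (hC : ∀ x, |H x| ≤ C)
    (hU : IsUniformOnUnit P₀ U) : P₀.map (fun ω => quantile ν H (U ω)) = ν.map H := by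
  have hm := measurable_quantile_comp (ν := ν) hH hC hU
  have : IsProbabilityMeasure (P₀.map fun ω => quantile ν H (U ω)) :=
    Measure.isProbabilityMeasure_map hm.aemeasurable
  refine Measure.ext_of_Iic _ _ fun x => ?_
  rw [Measure.map_apply hm measurableSet_Iic, Measure.map_apply hH measurableSet_Iic,
    ← measureReal_eq_measureReal_iff]
  have : (fun ω => quantile ν H (U ω)) ⁻¹' Set.Iic x = {ω | U ω ≤ ν.real {y | H y ≤ x}} := by
    ext ω
    exact quantile_le_iff hH hC (hU.mem_Ioc ω) x
  rw [this, hU.measureReal_le _ ⟨measureReal_nonneg, measureReal_le_one⟩]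
  rfl

theorem memLp_quantile_comp [IsProbabilityMeasure P₀] (hH : Measurable H) (hC : ∀ x, |H x| ≤ C)
    (hU : IsUniformOnUnit P₀ U) : MemLp (fun ω => quantile ν H (U ω)) ∞ P₀ :=
  MemLp.of_bound (measurable_quantile_comp hH hC hU).aestronglyMeasurable C
    (Eventually.of_forall fun ω => abs_quantile_le hH hC (hU.mem_Ioc ω))

end Quantile

/-! ### Continuity of law invariant risk measures -/

namespace IsLawInvariantRiskMeasure

variable {Ω₀ : Type*} [MeasurableSpace Ω₀] {P₀ : Measure Ω₀} [IsProbabilityMeasure P₀]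
  {ρ : Lp ℝ ∞ P₀ → ℝ}

theorem le_add_of_ae_le (hρ : IsLawInvariantRiskMeasure P₀ ρ) {X Y : Lp ℝ ∞ P₀} {c : ℝ}
    (h : ∀ᵐ ω ∂P₀, Y ω ≤ X ω + c) : ρ Y ≤ ρ X + c := by
  rw [← hρ.map_add_const]
  refine hρ.mono _ _ ?_
  filter_upwards [h, Lp.coeFn_add X (Lp.const ∞ P₀ c), Lp.coeFn_const (p := ∞) (μ := P₀) (c := c)]
    with ω h1 h2 h3
  rw [h2, Pi.add_apply, h3]
  exact h1

theorem le_of_ae_le_convex (hρ : IsLawInvariantRiskMeasure P₀ ρ) {X Y Z : Lp ℝ ∞ P₀} {t : ℝ}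
    (ht0 : 0 ≤ t) (ht1 : t ≤ 1) (h : ∀ᵐ ω ∂P₀, Z ω ≤ t * X ω + (1 - t) * Y ω) :
    ρ Z ≤ t * ρ X + (1 - t) * ρ Y := by
  refine (hρ.mono _ _ ?_).trans (hρ.convex X Y t ht0 ht1)
  filter_upwards [h, Lp.coeFn_add (t • X) ((1 - t) • Y), Lp.coeFn_smul t X,
    Lp.coeFn_smul (1 - t) Y] with ω h1 h2 h3 h4
  rw [h2, Pi.add_apply, h3, h4]
  exact h1

theorem neg_le_of_ae_abs_le (hρ : IsLawInvariantRiskMeasure P₀ ρ) {X : Lp ℝ ∞ P₀} {C : ℝ}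
    (hX : ∀ᵐ ω ∂P₀, |X ω| ≤ C) : -C ≤ ρ X := by
  have : ρ 0 ≤ ρ X + C := by
    refine hρ.le_add_of_ae_le ?_
    filter_upwards [hX, Lp.coeFn_zero ℝ ∞ P₀] with ω h1 h2
    rw [h2, Pi.zero_apply]
    linarith [(abs_le.1 h1).1]
  rw [hρ.map_zero] at this
  linarith

/-- Law invariance then allows a small event to be replaced by a sublevel set of `U`. -/
theorem map_indicatorConstLp_eq {A B : Set Ω₀} (hA : MeasurableSet A) (hB : MeasurableSet B)
    (hAB : P₀ A = P₀ B) (c : ℝ) :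
    P₀.map (indicatorConstLp ∞ hA (measure_ne_top P₀ A) c) =
      P₀.map (indicatorConstLp ∞ hB (measure_ne_top P₀ B) c) := by
  rw [Measure.map_congr indicatorConstLp_coeFn, Measure.map_congr indicatorConstLp_coeFn]
  ext s hs
  rw [Measure.map_apply (measurable_const.indicator hA) hs,
    Measure.map_apply (measurable_const.indicator hB) hs]
  classical
  have hc : P₀ Aᶜ = P₀ Bᶜ := by
    rw [prob_compl_eq_one_sub hA, prob_compl_eq_one_sub hB, hAB]
  rw [Set.indicator_const_preimage_eq_union, Set.indicator_const_preimage_eq_union]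
  split_ifs <;> simp [hAB, hc]

/-- The risk of `c • 1_A` vanishes with the probability of `A`. -/
theorem exists_pos_forall_indicatorConstLp_le (hρ : IsLawInvariantRiskMeasure P₀ ρ) {q : ℝ}
    (hq : 0 < q) (hfin : FiniteOnWeakMoment P₀ ρ q) {U : Ω₀ → ℝ} (hU : IsUniformOnUnit P₀ U)
    {c : ℝ} (hc : 0 ≤ c) {η : ℝ} (hη : 0 < η) :
    ∃ δ : ℝ, 0 < δ ∧ ∀ (A : Set Ω₀) (hA : MeasurableSet A), P₀.real A ≤ δ →
      ρ (indicatorConstLp ∞ hA (measure_ne_top P₀ A) c) ≤ η := by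
  -- A Pareto variable: `P₀[X ≥ t] = t ^ (-q)` for `t ≥ 1`.
  set X : Ω₀ → ℝ := fun ω => U ω ^ (-q)⁻¹ with hX_def
  have hX : Measurable X := hU.measurable.pow_const _
  have hX_pos : ∀ ω, 0 < X ω := fun ω => Real.rpow_pos_of_pos (hU.mem_Ioc ω).1 _
  have hX_iff : ∀ ω t, 0 < t → (t ≤ X ω ↔ U ω ≤ t ^ (-q)) := fun ω t ht =>
    Real.le_rpow_inv_iff_of_neg ht (hU.mem_Ioc ω).1 (by linarith)
  have hpow : ∀ t : ℝ, 1 ≤ t → t ^ (-q) ∈ Set.Icc (0 : ℝ) 1 := fun t ht =>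
    ⟨by positivity, Real.rpow_le_one_of_one_le_of_nonpos ht (by linarith)⟩
  obtain ⟨K, hK⟩ := hfin X hX.aemeasurable ⟨1, zero_le_one, fun t ht => by
    simp only [abs_of_pos (hX_pos _), hX_iff _ t (by linarith), one_mul]
    exact (hU.measureReal_le _ (hpow t ht)).le⟩
  -- The truncation level `k` makes `c / k` a convex weight and `c * |K| / k` at most `η`.
  obtain ⟨k, hk⟩ := exists_nat_ge (max 1 (max c (c * |K| / η)))
  simp only [max_le_iff] at hk
  obtain ⟨hk1, hkc, hkK⟩ := hk
  have hk0 : (0 : ℝ) < k := by linarith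
  refine ⟨(k : ℝ) ^ (-q), by positivity, fun A hA hPA => ?_⟩
  have hB : MeasurableSet {ω | U ω ≤ P₀.real A} := hU.measurable measurableSet_Iic
  have hAB : P₀ A = P₀ {ω | U ω ≤ P₀.real A} := by
    rw [← measureReal_eq_measureReal_iff, hU.measureReal_le _ ⟨measureReal_nonneg, measureReal_le_one⟩]
  rw [hρ.law_invariant _ _ (map_indicatorConstLp_eq hA hB hAB c)]
  have hY : MemLp (fun ω => min |X ω| k) ∞ P₀ := by
    refine MemLp.of_bound (hX.abs.min measurable_const).aestronglyMeasurable k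
      (Eventually.of_forall fun ω => ?_)
    rw [Real.norm_eq_abs, abs_of_nonneg (le_min (abs_nonneg _) hk0.le)]
    exact min_le_right _ _
  have hρY : ρ hY.toLp ≤ K := hK k _ hY.coeFn_toLp
  -- Since `P₀.real A ≤ k ^ (-q)`, the event forces `X ≥ k`, whence `c • 1_B ≤ (c / k) (X ∧ k)`.
  have hconv : ρ (indicatorConstLp ∞ hB (measure_ne_top P₀ _) c) ≤
      c / k * ρ hY.toLp + (1 - c / k) * ρ 0 := by
    refine hρ.le_of_ae_le_convex (by positivity) ((div_le_one hk0).2 hkc) ?_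
    filter_upwards [indicatorConstLp_coeFn (p := ∞) (hs := hB) (hμs := measure_ne_top P₀ _) (c := c),
      hY.coeFn_toLp, Lp.coeFn_zero ℝ ∞ P₀] with ω h1 h2 h3
    rw [h1, h2, h3, Pi.zero_apply, mul_zero, add_zero, abs_of_pos (hX_pos ω)]
    by_cases hω : U ω ≤ P₀.real A
    · rw [Set.indicator_of_mem (by exact hω),
        min_eq_right ((hX_iff ω k hk0).2 (hω.trans hPA)), div_mul_cancel₀ _ hk0.ne']
    · rw [Set.indicator_of_notMem (by exact hω)]
      have := (hX_pos ω).le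
      positivity
  rw [hρ.map_zero, mul_zero, add_zero] at hconv
  refine hconv.trans ?_
  have h1 : c / k * ρ hY.toLp ≤ c / k * |K| := by
    gcongr
    exact hρY.trans (le_abs_self K)
  refine h1.trans ?_
  rw [div_mul_eq_mul_div, div_le_iff₀ hk0]
  rw [div_le_iff₀ hη] at hkK
  linarith

/-- On bounded sets, the risk measure is uniformly continuous for convergence in probability. -/
theorem exists_pos_forall_le_add (hρ : IsLawInvariantRiskMeasure P₀ ρ) {q : ℝ}
    (hq : 0 < q) (hfin : FiniteOnWeakMoment P₀ ρ q) {U : Ω₀ → ℝ} (hU : IsUniformOnUnit P₀ U)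
    {C : ℝ} (hC : 0 ≤ C) {η : ℝ} (hη : 0 < η) :
    ∃ δ : ℝ, 0 < δ ∧ ∀ X Y : Lp ℝ ∞ P₀, (∀ᵐ ω ∂P₀, |X ω| ≤ C) → (∀ᵐ ω ∂P₀, |Y ω| ≤ C) →
      P₀.real {ω | X ω + δ < Y ω} ≤ δ → ρ Y ≤ ρ X + η := by
  -- The total error below is at most `t + t * C + d = t * (1 + 3 * C) + 2 * δ`, half of `η` for
  -- each summand.
  set t : ℝ := min (1 / 2) (η / (2 * (1 + 3 * C))) with ht
  have ht0 : 0 < t := by positivity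
  have ht2 : t ≤ 1 / 2 := min_le_left _ _
  have htη : t * (1 + 3 * C) ≤ η / 2 := by
    have h := min_le_right (1 / 2) (η / (2 * (1 + 3 * C)))
    rw [← ht, le_div_iff₀ (by positivity)] at h
    linarith
  obtain ⟨δ₀, hδ₀, hind⟩ := hρ.exists_pos_forall_indicatorConstLp_le hq hfin hU
    (c := 2 * C / t) (by positivity) one_pos
  refine ⟨min δ₀ (η / 4), by positivity, fun X Y hX hY hPA => ?_⟩
  set δ := min δ₀ (η / 4)
  have hδ0 : 0 < δ := by positivity
  have hδη : δ ≤ η / 4 := min_le_right _ _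
  have hA : MeasurableSet {ω | X ω + δ < Y ω} :=
    measurableSet_lt ((Lp.stronglyMeasurable X).measurable.add_const δ)
      (Lp.stronglyMeasurable Y).measurable
  have hW := hind _ hA (hPA.trans (min_le_left _ _))
  set W := indicatorConstLp ∞ hA (measure_ne_top P₀ _) (2 * C / t)
  set d : ℝ := 2 * t * C + 2 * δ
  -- On the bad event `t * W = 2 * C` bridges the gap between `X` and `Y`. Elsewhere `d` compensates
  -- for both `δ` and the factor `1 - t ≥ 1 / 2` in front of `X`.
  have hconv : ρ Y ≤ t * ρ W + (1 - t) * ρ (X + Lp.const ∞ P₀ d) := by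
    refine hρ.le_of_ae_le_convex ht0.le (by linarith) ?_
    filter_upwards [hX, hY, indicatorConstLp_coeFn (p := ∞) (hs := hA)
      (hμs := measure_ne_top P₀ _) (c := 2 * C / t), Lp.coeFn_add X (Lp.const ∞ P₀ d),
      Lp.coeFn_const (p := ∞) (μ := P₀) (c := d)] with ω h1 h2 h3 h4 h5
    rw [h3, h4, Pi.add_apply, h5, Function.const_apply]
    have hb1 := abs_le.1 h1
    have hb2 := abs_le.1 h2
    have hd : X ω + δ ≤ (1 - t) * (X ω + d) := by
      have e1 : t * X ω ≤ t * C := mul_le_mul_of_nonneg_left hb1.2 ht0.le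
      have e2 : 1 / 2 * d ≤ (1 - t) * d :=
        mul_le_mul_of_nonneg_right (by linarith) (by positivity)
      have e3 : 1 / 2 * d = t * C + δ := by ring
      linarith
    by_cases hω : X ω + δ < Y ω
    · rw [Set.indicator_of_mem (by exact hω), mul_div_cancel₀ _ ht0.ne']
      linarith
    · rw [Set.indicator_of_notMem (by exact hω)]
      linarith
  rw [hρ.map_add_const] at hconv
  have hX0 := hρ.neg_le_of_ae_abs_le hX
  have e1 : t * ρ W ≤ t * 1 := mul_le_mul_of_nonneg_left hW ht0.le
  have e2 : t * (-C) ≤ t * ρ X := mul_le_mul_of_nonneg_left hX0 ht0.le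
  have e3 : 0 ≤ t * d := by positivity
  have e4 : d = 2 * t * C + 2 * δ := rfl
  nlinarith

/-! ### Consistency for law invariant risk measures -/

variable {𝒳 : Type*} [MeasurableSpace 𝒳] {U : Ω₀ → ℝ}

theorem riskUnderLaw_eq (hρ : IsLawInvariantRiskMeasure P₀ ρ) (hU : IsUniformOnUnit P₀ U)
    {ν : Measure 𝒳} [IsProbabilityMeasure ν] {H : 𝒳 → ℝ} (hH : Measurable H) {C : ℝ}
    (hC : ∀ x, |H x| ≤ C) :
    riskUnderLaw ρ ν H = ρ (memLp_quantile_comp (ν := ν) hH hC hU).toLp := by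
  have hlaw : P₀.map (memLp_quantile_comp (ν := ν) hH hC hU).toLp = ν.map H := by
    rw [Measure.map_congr (MemLp.coeFn_toLp _), map_quantile_comp hH hC hU]
  refine le_antisymm (iInf₂_le (f := fun (X : Lp ℝ ∞ P₀) (_ : P₀.map X = ν.map H) => (ρ X : EReal)) _ hlaw) (le_iInf₂ fun X hX => ?_)
  rw [hρ.law_invariant _ X (hlaw.trans hX.symm)]

theorem monotoneCashAdditive_riskUnderLaw (hρ : IsLawInvariantRiskMeasure P₀ ρ)
    (hU : IsUniformOnUnit P₀ U) (ν : Measure 𝒳) [IsProbabilityMeasure ν] :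
    MonotoneCashAdditive (riskUnderLaw ρ) ν := by
  rintro H H' hH hH' ⟨C, hC⟩ ⟨C', hC'⟩ ε hle a ha
  rw [hρ.riskUnderLaw_eq hU hH hC, EReal.coe_lt_coe_iff] at ha
  rw [hρ.riskUnderLaw_eq hU hH' hC', EReal.coe_lt_coe_iff]
  refine (hρ.le_add_of_ae_le ?_).trans_lt (add_lt_add_left ha ε)
  filter_upwards [(memLp_quantile_comp (ν := ν) hH hC hU).coeFn_toLp,
    (memLp_quantile_comp (ν := ν) hH' hC' hU).coeFn_toLp] with ω h1 h2
  rw [h1, h2]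
  exact quantile_le_quantile_add hH hC hH' hC' hle (hU.mem_Ioc ω)

/-- Two quantile couplings differ by more than a grid width only if the distribution functions
are separated at a grid point. -/
theorem measureReal_quantile_add_lt_quantile_le (hU : IsUniformOnUnit P₀ U)
    (ν ν' : Measure 𝒳) [IsProbabilityMeasure ν] [IsProbabilityMeasure ν'] {H : 𝒳 → ℝ}
    (hH : Measurable H) {C : ℝ} (hC : ∀ x, |H x| ≤ C) (n : ℕ) :
    P₀.real {ω | quantile ν H (U ω) + 1 / ((n : ℝ) + 1) < quantile ν' H (U ω)} ≤
      ∑ j ∈ Finset.Icc ⌈-C * (n + 1)⌉ ⌈C * (n + 1)⌉,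
        |ν.real {x | H x ≤ j / ((n : ℝ) + 1)} - ν'.real {x | H x ≤ j / ((n : ℝ) + 1)}| := by
  have hn : (0 : ℝ) < n + 1 := by positivity
  have hsub : {ω | quantile ν H (U ω) + 1 / ((n : ℝ) + 1) < quantile ν' H (U ω)} ⊆
      ⋃ j ∈ Finset.Icc ⌈-C * (n + 1)⌉ ⌈C * (n + 1)⌉,
        {ω | ν'.real {x | H x ≤ j / ((n : ℝ) + 1)} < U ω ∧
          U ω ≤ ν.real {x | H x ≤ j / ((n : ℝ) + 1)}} := by
    intro ω hω
    have hω' : quantile ν H (U ω) + 1 / ((n : ℝ) + 1) < quantile ν' H (U ω) := hω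
    have hb := abs_le.1 (abs_quantile_le (ν := ν) hH hC (hU.mem_Ioc ω))
    set a := quantile ν H (U ω) with ha
    simp only [Set.mem_iUnion]
    -- This `j` gives the least grid point `j / (n + 1) ≥ a`; it is below `a + 1 / (n + 1)`, hence
    -- below the other quantile.
    refine ⟨⌈a * (n + 1)⌉, Finset.mem_Icc.2 ⟨Int.ceil_mono (by nlinarith),
      Int.ceil_mono (by nlinarith)⟩, ?_, ?_⟩
    · rw [← not_le, ← quantile_le_iff hH hC (hU.mem_Ioc ω), not_le]
      refine lt_of_le_of_lt ?_ hω'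
      rw [div_le_iff₀ hn, add_mul, one_div, inv_mul_cancel₀ hn.ne']
      exact (Int.ceil_lt_add_one _).le
    · rw [← quantile_le_iff hH hC (hU.mem_Ioc ω), ← ha, le_div_iff₀ hn]
      exact Int.le_ceil _
  refine (measureReal_mono hsub (measure_ne_top _ _)).trans ((measureReal_biUnion_finset_le _ _).trans ?_)
  exact Finset.sum_le_sum fun j _ => hU.measureReal_Ioc_le
    ⟨measureReal_nonneg, measureReal_le_one⟩ ⟨measureReal_nonneg, measureReal_le_one⟩

/-- For a given accuracy one finite grid suffices, so only countably many distribution function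
values need to converge. The coupling bound is symmetric in the two measures and gives both
inequalities. -/
theorem ae_tendsto_riskUnderLaw (hρ : IsLawInvariantRiskMeasure P₀ ρ) {q : ℝ} (hq : 0 < q)
    (hfin : FiniteOnWeakMoment P₀ ρ q) (hU : IsUniformOnUnit P₀ U)
    {Ω : Type*} [MeasurableSpace Ω] {μ : Measure 𝒳} [IsProbabilityMeasure μ] {P : Measure Ω}
    {S : ℕ → Ω → 𝒳} (hS_indep : iIndepFun S P) (hS_law : ∀ n, HasLaw (S n) μ P)
    {H : 𝒳 → ℝ} (hH : Measurable H) (hH_bdd : ∃ C, ∀ x, |H x| ≤ C) :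
    ∀ᵐ ω ∂P, Tendsto (fun N => riskUnderLaw ρ (empiricalMeasure S N ω) H) atTop
      (𝓝 (riskUnderLaw ρ μ H)) := by
  obtain ⟨C, hC0, hC⟩ : ∃ C, 0 ≤ C ∧ ∀ x, |H x| ≤ C := by
    obtain ⟨C, hC⟩ := hH_bdd
    exact ⟨|C|, abs_nonneg _, fun x => (hC x).trans (le_abs_self _)⟩
  have hae : ∀ᵐ ω ∂P, ∀ (n : ℕ) (j : ℤ), Tendsto
      (fun N => (empiricalMeasure S N ω).real {x | H x ≤ j / ((n : ℝ) + 1)}) atTop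
      (𝓝 (μ.real {x | H x ≤ j / ((n : ℝ) + 1)})) := by
    refine ae_all_iff.2 fun n => ae_all_iff.2 fun j => ?_
    have hs : MeasurableSet {x | H x ≤ j / ((n : ℝ) + 1)} := hH measurableSet_Iic
    have h := ae_tendsto_integral_empiricalMeasure hS_indep hS_law
      (f := Set.indicator {x | H x ≤ j / ((n : ℝ) + 1)} 1) (measurable_one.indicator hs)
      ⟨1, fun x => by
        by_cases hx : x ∈ {x | H x ≤ j / ((n : ℝ) + 1)} <;> simp [Set.indicator, hx]⟩
    simpa only [integral_indicator_one hs] using h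
  filter_upwards [hae] with ω hω
  have hreal : ∀ η : ℝ, 0 < η → ∀ᶠ N in atTop, ∃ r : ℝ, riskUnderLaw ρ (empiricalMeasure S N ω) H = r ∧
      |r - ρ (memLp_quantile_comp (ν := μ) hH hC hU).toLp| ≤ η := by
    intro η hη
    obtain ⟨δ, hδ, hmod⟩ := hρ.exists_pos_forall_le_add hq hfin hU hC0 hη
    obtain ⟨n, hn⟩ := exists_nat_one_div_lt hδ
    have hsum : Tendsto (fun N => ∑ j ∈ Finset.Icc ⌈-C * (n + 1)⌉ ⌈C * (n + 1)⌉,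
        |(empiricalMeasure S N ω).real {x | H x ≤ j / ((n : ℝ) + 1)} -
          μ.real {x | H x ≤ j / ((n : ℝ) + 1)}|) atTop (𝓝 0) := by
      rw [← Finset.sum_const_zero (s := Finset.Icc ⌈-C * ((n : ℝ) + 1)⌉ ⌈C * (n + 1)⌉)]
      refine tendsto_finsetSum _ fun j _ => ?_
      simpa using ((hω n j).sub_const (μ.real {x | H x ≤ j / ((n : ℝ) + 1)})).abs
    filter_upwards [hsum.eventually_le_const hδ, eventually_ge_atTop 1] with N hN hN1
    have := isProbabilityMeasure_empiricalMeasure S hN1 ω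
    refine ⟨_, hρ.riskUnderLaw_eq hU hH hC, ?_⟩
    have hclose : ∀ ν ν' : Measure 𝒳, (hν : IsProbabilityMeasure ν) →
        (hν' : IsProbabilityMeasure ν') →
        ∑ j ∈ Finset.Icc ⌈-C * (n + 1)⌉ ⌈C * (n + 1)⌉,
          |ν.real {x | H x ≤ j / ((n : ℝ) + 1)} - ν'.real {x | H x ≤ j / ((n : ℝ) + 1)}| ≤ δ →
        ρ (memLp_quantile_comp (ν := ν') hH hC hU).toLp ≤
          ρ (memLp_quantile_comp (ν := ν) hH hC hU).toLp + η := by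
      intro ν ν' _ _ hle
      have h1 := (memLp_quantile_comp (ν := ν) hH hC hU).coeFn_toLp
      have h2 := (memLp_quantile_comp (ν := ν') hH hC hU).coeFn_toLp
      refine hmod _ _ ?_ ?_ (le_trans ?_
        ((measureReal_quantile_add_lt_quantile_le hU ν ν' hH hC n).trans hle))
      · filter_upwards [h1] with ω' h
        exact h ▸ abs_quantile_le hH hC (hU.mem_Ioc ω')
      · filter_upwards [h2] with ω' h
        exact h ▸ abs_quantile_le hH hC (hU.mem_Ioc ω')
      · refine ENNReal.toReal_mono (measure_ne_top _ _) (measure_mono_ae ?_)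
        filter_upwards [h1, h2] with ω' e1 e2 hlt
        have hlt' : _ + δ < _ := hlt
        rw [e1, e2] at hlt'
        exact (add_lt_add_right hn _).trans hlt'
    rw [abs_sub_le_iff]
    constructor
    · have := hclose μ _ inferInstance this (by simpa only [abs_sub_comm] using hN)
      linarith
    · have := hclose _ μ this inferInstance hN
      linarith
  rw [hρ.riskUnderLaw_eq hU hH hC, tendsto_order]
  constructor
  · intro b hb
    obtain ⟨c, hbc, hc⟩ := EReal.lt_iff_exists_real_btwn.1 hb
    rw [EReal.coe_lt_coe_iff] at hc
    filter_upwards [hreal _ (sub_pos.2 hc)] with N ⟨r, hr, hle⟩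
    rw [hr]
    exact hbc.trans_le (EReal.coe_le_coe_iff.2 (by linarith [(abs_le.1 hle).1]))
  · intro b hb
    obtain ⟨c, hc, hcb⟩ := EReal.lt_iff_exists_real_btwn.1 hb
    rw [EReal.coe_lt_coe_iff] at hc
    filter_upwards [hreal _ (sub_pos.2 hc)] with N ⟨r, hr, hle⟩
    rw [hr]
    exact (EReal.coe_le_coe_iff.2 (by linarith [(abs_le.1 hle).2])).trans_lt hcb

end IsLawInvariantRiskMeasure

theorem mainTheorem9 {𝒳 Ω : Type*} [MeasurableSpace 𝒳] [MeasurableSpace Ω]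
    (μ : Measure 𝒳) [IsProbabilityMeasure μ] (P : Measure Ω) [IsProbabilityMeasure P]
    -- an i.i.d. sample of `μ`
    (S : ℕ → Ω → 𝒳) (hS_indep : iIndepFun S P) (hS_law : ∀ n, HasLaw (S n) μ P)
    -- bounded measurable positions, prices, and a bounded set of strategies
    (F : 𝒳 → ℝ) (hF : Measurable F) (hF_bdd : ∃ C, ∀ x, |F x| ≤ C)
    {e : ℕ} (G : Fin e → 𝒳 → ℝ) (hG : ∀ i, Measurable (G i)) (hG_bdd : ∀ i, ∃ C, ∀ x, |G i x| ≤ C)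
    (p : Fin e → ℝ) (𝒢 : Set (Fin e → ℝ)) (h𝒢 : Bornology.IsBounded 𝒢) :
    -- optimized certainty equivalents
    (∀ l : ℝ → ℝ, IsLossFunction l →
      ∀ᵐ ω ∂P, Tendsto (fun N => hedgedRisk (oce l) G p 𝒢 (empiricalMeasure S N ω) F) atTop
        (𝓝 (hedgedRisk (oce l) G p 𝒢 μ F))) ∧
    -- shortfall risk
    (∀ l : ℝ → ℝ, IsLossFunction l → StrictMono l →
      ∀ᵐ ω ∂P, Tendsto (fun N => hedgedRisk (shortfallRisk l) G p 𝒢 (empiricalMeasure S N ω) F)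
        atTop (𝓝 (hedgedRisk (shortfallRisk l) G p 𝒢 μ F))) ∧
    -- general law invariant risk measures on a standard (atomless) probability space
    (∀ (Ω₀ : Type w) [MeasurableSpace Ω₀] [StandardBorelSpace Ω₀] (P₀ : Measure Ω₀)
      [IsProbabilityMeasure P₀] [NullSingletonClass P₀] (ρ : Lp ℝ ∞ P₀ → ℝ) (q : ℝ),
      IsLawInvariantRiskMeasure P₀ ρ → 1 < q → FiniteOnWeakMoment P₀ ρ q →
      ∀ᵐ ω ∂P, Tendsto
        (fun N => hedgedRisk (riskUnderLaw ρ) G p 𝒢 (empiricalMeasure S N ω) F)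
        atTop (𝓝 (hedgedRisk (riskUnderLaw ρ) G p 𝒢 μ F))) := by
  refine ⟨fun l hl => ?_, fun l hl hl_strict => ?_, fun Ω₀ _ _ P₀ _ _ ρ q hρ hq hfin => ?_⟩
  · exact ae_tendsto_hedgedRisk hF hF_bdd hG hG_bdd p h𝒢
      (fun ν _ => monotoneCashAdditive_oce hl ν)
      fun H hH hH_bdd => ae_tendsto_oce hl hS_indep hS_law hH hH_bdd
  · exact ae_tendsto_hedgedRisk hF hF_bdd hG hG_bdd p h𝒢
      (fun ν _ => monotoneCashAdditive_shortfallRisk hl ν)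
      fun H hH hH_bdd => ae_tendsto_shortfallRisk hl hl_strict hS_indep hS_law hH hH_bdd
  · obtain ⟨U, hU⟩ := exists_isUniformOnUnit P₀
    exact ae_tendsto_hedgedRisk hF hF_bdd hG hG_bdd p h𝒢
      (fun ν _ => hρ.monotoneCashAdditive_riskUnderLaw hU ν)
      fun H hH hH_bdd => hρ.ae_tendsto_riskUnderLaw (by linarith) hfin hU hS_indep hS_law hH hH_bdd
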